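/- Let $d\ge 2$, $\kappa_d=\pi^{d/2}/\Gamma(\frac d2+1)$ and $A=\sqrt d\,\kappa_d^{1/d}$. There is a constant $B\ge 1$ depending only on $d$ such that the following holds. Let $(r_k)_{k\ge 0}$ be positive numbers with $r_0=1$, $r_{k+1}<r_k/B$, $r_k/r_{k+1}\in\mathbb N$ and $1/r_k\in\mathbb N$ for all $k\ge 0$, and put $\delta_{k}=A\big((r_{k}/r_{k-1})^{d-1}\big)^{1/d}$ for $k\ge1$. Let a set $E\subset\mathbb R^d$ be constructed as follows. Generation $0$ consists of the single closed ball $\widetilde B^0_1=B(0,1)$. Given the closed balls $\widetilde B^k_j$ of generation $k$, of radius $r_k$, choose for each of them $(r_k/r_{k+1})^{d-1}$ closed cubes of side length $(\kappa_d r_{k+1}^{d-1}r_k)^{1/d}$ with pairwise disjoint interiors, contained in the concentric dilated ball $B^k_j=(1+\delta_{k+1})\widetilde B^k_j$; the balls of generation $k+1$ are the closed balls of radius $r_{k+1}$ centered at the centers of all the cubes so chosen. Set $E^k=\bigcup_j B^k_j$ and $E=\bigcap_{k\ge0}E^k$. If $\sum_{k\ge1}\delta_k^{1/d}<\infty$,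 then $E$ is purely $(d-1)$-unrectifiable; that is, $\mathcal H^{d-1}(E\cap F)=0$ for every $(d-1)$-rectifiable set $F\subset\mathbb R^d$. Here $F$ is called $(d-1)$-rectifiable if there are Lipschitz maps $f_i:\mathbb R^{d-1}\to\mathbb R^d$, $i=1,2,\dots$, with $\mathcal H^{d-1}\big(F\setminus\bigcup_i f_i(\mathbb R^{d-1})\big)=0$. -/

import Mathlib

open MeasureTheory

noncomputable section

namespace PackedCantor

/-- `ℝ^d` with the Euclidean norm. -/
abbrev Space (d : ℕ) : Type := EuclideanSpace ℝ (Fin d)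

/-- A set `F ⊆ ℝ^d` is `n`-rectifiable if countably many Lipschitz images of `ℝ^n` cover
`H^n`-almost all of it. -/
def Rectifiable {d : ℕ} (n : ℕ) (F : Set (Space d)) : Prop :=
  ∃ f : ℕ → Space n → Space d,
    (∀ i, ∃ K : NNReal, LipschitzWith K (f i)) ∧
      μH[(n : ℝ)] (F \ ⋃ i, Set.range (f i)) = 0

/-- A set is purely `n`-unrectifiable if it meets every `n`-rectifiable set in an `H^n`-null set. -/
def PurelyUnrectifiable {d : ℕ} (n : ℕ) (E : Set (Space d)) : Prop :=
  ∀ F : Set (Space d), Rectifiable n F → μH[(n : ℝ)] (E ∩ F) = 0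

/-- The constant `κ_d = π^{d/2} / Γ(d/2 + 1)`, the volume of the unit ball of `ℝ^d`. -/
def kappa (d : ℕ) : ℝ :=
  Real.pi ^ ((d : ℝ) / 2) / Real.Gamma ((d : ℝ) / 2 + 1)

/-- The constant `A = √d · κ_d^{1/d}`. -/
def constA (d : ℕ) : ℝ :=
  Real.sqrt d * kappa d ^ (1 / (d : ℝ))

/-- `δ_k = A ((r_k / r_{k-1})^{d-1})^{1/d}`; only used for `k ≥ 1`. -/
def delta (d : ℕ) (r : ℕ → ℝ) (k : ℕ) : ℝ :=
  constA d * ((r k / r (k - 1)) ^ (d - 1)) ^ (1 / (d : ℝ))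

/-- The side length `(κ_d r_k^{d-1} r_{k-1})^{1/d}` of the cubes of generation `k`;
only used for `k ≥ 1`. -/
def side (d : ℕ) (r : ℕ → ℝ) (k : ℕ) : ℝ :=
  (kappa d * r k ^ (d - 1) * r (k - 1)) ^ (1 / (d : ℝ))

/-- The admissible sequences of radii, for a given lower bound `B` on the ratios. -/
structure RadiusSeq (B : ℝ) (r : ℕ → ℝ) : Prop where
  pos : ∀ k, 0 < r k
  zero : r 0 = 1
  lt_div : ∀ k, r (k + 1) < r k / B
  ratio_nat : ∀ k, ∃ n : ℕ, r k / r (k + 1) = n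
  inv_nat : ∀ k, ∃ n : ℕ, 1 / r k = n

/-- The closed cube with center `z` and side length `s`, whose sides are parallel to the coordinate
axes after the rotation `U`. -/
def cube {d : ℕ} (U : Space d ≃ₗᵢ[ℝ] Space d) (z : Space d) (s : ℝ) : Set (Space d) :=
  {x | ∀ i, |U (x - z) i| ≤ s / 2}

/-- A run of the Cantor construction with radii `r`. Generation `k` consists of `count k` balls of
radius `r k`, with centers `center k j`. Generation `0` is the unit ball centered at the origin.
Each ball of generation `k` has `(r k / r (k+1))^(d-1)` children: the centers of the children are
the centers of cubes of side length `side d r (k+1)` which have pairwise disjoint interiors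
and are contained in the ball dilated by the factor `1 + δ_{k+1}`. -/
structure Construction (d : ℕ) (r : ℕ → ℝ) where
  count : ℕ → ℕ
  center : (k : ℕ) → Fin (count k) → Space d
  parent : (k : ℕ) → Fin (count (k + 1)) → Fin (count k)
  rot : (k : ℕ) → Fin (count (k + 1)) → (Space d ≃ₗᵢ[ℝ] Space d)
  count_zero : count 0 = 1
  center_zero : ∀ j, center 0 j = 0
  card_children : ∀ k (j : Fin (count k)),
    ((Finset.univ.filter fun l => parent k l = j).card : ℝ) = (r k / r (k + 1)) ^ (d - 1)
  cube_subset : ∀ k (l : Fin (count (k + 1))),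
    cube (rot k l) (center (k + 1) l) (side d r (k + 1)) ⊆
      Metric.closedBall (center k (parent k l)) ((1 + delta d r (k + 1)) * r k)
  cube_disjoint : ∀ k (l l' : Fin (count (k + 1))), l ≠ l' → parent k l = parent k l' →
    Disjoint (interior (cube (rot k l) (center (k + 1) l) (side d r (k + 1))))
      (interior (cube (rot k l') (center (k + 1) l') (side d r (k + 1))))

/-- `E^k`, the union of the dilated balls `(1 + δ_{k+1}) B(z, r_k)` of generation `k`. -/
def Construction.level {d : ℕ} {r : ℕ → ℝ} (C : Construction d r) (k : ℕ) : Set (Space d) :=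
  ⋃ j : Fin (C.count k), Metric.closedBall (C.center k j) ((1 + delta d r (k + 1)) * r k)

/-- The Cantor set `E`, the intersection of all the `E^k`. -/
def Construction.limitSet {d : ℕ} {r : ℕ → ℝ} (C : Construction d r) : Set (Space d) :=
  ⋂ k, C.level k

end PackedCantor

end

open MeasureTheory Filter Topology

namespace PackedCantor

/-! The set `E` has gaps too wide for a Lipschitz image to follow. For large `B` the dilated balls
of generation `k+1` are small compared with the cubes around them, so the centers are separated by
the cube side `s` (`side_le_dist_center`), and two points of `E` at distance at most `s/3` share a
dilated ball and are within `4 r_{k+1}` (`dist_le_of_dist_le`). Cut a box in `ℝ^n`, `n = d-1`, into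
about `s^{-n}` cells whose Lipschitz images have diameter at most `s/3`. Each image meets `E` in a
set of diameter at most `4 r_{k+1}`, so the total `H^n` cost is of order `(r_{k+1}/s)^n`
(`hausdorffMeasure_inter_image_box_eq_zero`). This tends to `0` because `(r_{k+1}/s)^d` is
proportional to `r_{k+1}/r_k`; summability serves only to make that ratio tend to `0`. -/

lemma kappa_pos (d : ℕ) : 0 < kappa d := by
  unfold kappa
  have : 0 < Real.Gamma ((d : ℝ) / 2 + 1) := Real.Gamma_pos_of_pos (by positivity)
  positivity

lemma constA_pos {d : ℕ} (hd : 0 < d) : 0 < constA d := by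
  unfold constA
  have h1 := kappa_pos d
  have h2 : (0 : ℝ) < d := by exact_mod_cast hd
  positivity

lemma closedBall_subset_cube {d : ℕ} (U : Space d ≃ₗᵢ[ℝ] Space d) (z : Space d) (s : ℝ) :
    Metric.closedBall z (s / 2) ⊆ cube U z s := by
  intro x hx i
  rw [Metric.mem_closedBall, dist_eq_norm] at hx
  calc |U (x - z) i| = ‖U (x - z) i‖ := rfl
    _ ≤ ‖U (x - z)‖ := PiLp.norm_apply_le _ i
    _ = ‖x - z‖ := U.norm_map _
    _ ≤ s / 2 := hx

/-- Disjoint open balls of equal radius have their centers at least a diameter apart. -/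
lemma le_dist_of_disjoint_ball {d : ℕ} {z z' : Space d} {s : ℝ}
    (h : Disjoint (Metric.ball z (s / 2)) (Metric.ball z' (s / 2))) : s ≤ dist z z' := by
  by_contra! hlt
  have h1 : dist z (midpoint ℝ z z') < s / 2 := by
    rw [dist_left_midpoint]; norm_num; linarith
  have h2 : dist z' (midpoint ℝ z z') < s / 2 := by
    rw [dist_right_midpoint]; norm_num; linarith
  exact Set.disjoint_left.1 h (Metric.mem_ball'.2 h1) (Metric.mem_ball'.2 h2)

/-! ### Asymptotics of radii, dilations and cube sides -/

namespace RadiusSeq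

variable {B : ℝ} {r : ℕ → ℝ}

lemma mul_lt (hr : RadiusSeq B r) (hB : 1 ≤ B) (k : ℕ) : B * r (k + 1) < r k := by
  have := hr.lt_div k
  rw [lt_div_iff₀ (by linarith)] at this
  linarith

lemma succ_le (hr : RadiusSeq B r) (hB : 1 ≤ B) (k : ℕ) : r (k + 1) ≤ r k := by
  nlinarith [hr.mul_lt hB k, hr.pos (k + 1)]

lemma le_one (hr : RadiusSeq B r) (hB : 1 ≤ B) (k : ℕ) : r k ≤ 1 :=
  (antitone_nat_of_succ_le (hr.succ_le hB) k.zero_le).trans hr.zero.le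

lemma side_pos (hr : RadiusSeq B r) (d k : ℕ) : 0 < side d r k := by
  have h1 := kappa_pos d
  have h2 := hr.pos k
  have h3 := hr.pos (k - 1)
  unfold side
  positivity

lemma side_pow (hr : RadiusSeq B r) {d : ℕ} (hd : 0 < d) (k : ℕ) :
    side d r k ^ d = kappa d * r k ^ (d - 1) * r (k - 1) := by
  have h1 := kappa_pos d
  have h2 := hr.pos k
  have h3 := hr.pos (k - 1)
  unfold side
  rw [one_div, Real.rpow_inv_natCast_pow (by positivity) hd.ne']

lemma delta_nonneg (hr : RadiusSeq B r) {d : ℕ} (hd : 0 < d) (k : ℕ) : 0 ≤ delta d r k := by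
  have h1 := constA_pos hd
  have h2 := hr.pos k
  have h3 := hr.pos (k - 1)
  unfold delta
  positivity

lemma delta_pow (hr : RadiusSeq B r) {d : ℕ} (hd : 0 < d) (k : ℕ) :
    delta d r k ^ d = constA d ^ d * (r k / r (k - 1)) ^ (d - 1) := by
  have h2 := hr.pos k
  have h3 := hr.pos (k - 1)
  unfold delta
  rw [mul_pow, one_div, Real.rpow_inv_natCast_pow (by positivity) hd.ne']

lemma delta_le_one (hr : RadiusSeq B r) (hB : 1 ≤ B) {d : ℕ} (hd : 2 ≤ d)
    (hA : constA d ^ d ≤ B) (k : ℕ) : delta d r (k + 1) ≤ 1 := by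
  have hd0 : 0 < d := by omega
  have hA0 := constA_pos hd0
  refine (pow_le_one_iff_of_nonneg (hr.delta_nonneg hd0 _) hd0.ne').1 ?_
  rw [hr.delta_pow hd0, Nat.add_sub_cancel]
  have h0 := hr.pos k
  have h1 := hr.pos (k + 1)
  have h2 : r (k + 1) / r k ≤ 1 := (div_le_one h0).2 (hr.succ_le hB k)
  calc constA d ^ d * (r (k + 1) / r k) ^ (d - 1)
      ≤ B * (r (k + 1) / r k) ^ 1 := by
        gcongr ?_ * ?_
        exact pow_le_pow_of_le_one (by positivity) h2 (by omega)
    _ ≤ 1 := by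
        rw [pow_one, ← mul_div_assoc, div_le_one h0]
        exact (hr.mul_lt hB k).le

/-- The `d`-th power of side over radius is `κ_d r_k / r_{k+1} > κ_d B ≥ 8^d`. -/
lemma eight_mul_le_side (hr : RadiusSeq B r) (hB : 1 ≤ B) {d : ℕ} (hd : 0 < d)
    (hκ : 8 ^ d / kappa d ≤ B) (k : ℕ) : 8 * r (k + 1) ≤ side d r (k + 1) := by
  have hk := kappa_pos d
  have h1 := hr.pos (k + 1)
  refine (pow_le_pow_iff_left₀ (by positivity) (hr.side_pos d _).le hd.ne').1 ?_
  rw [hr.side_pow hd, Nat.add_sub_cancel, mul_pow]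
  obtain ⟨n, rfl⟩ : ∃ n, d = n + 1 := ⟨d - 1, by omega⟩
  rw [div_le_iff₀ hk] at hκ
  calc (8 : ℝ) ^ (n + 1) * r (k + 1) ^ (n + 1)
      ≤ B * kappa (n + 1) * r (k + 1) ^ (n + 1) := by gcongr
    _ = kappa (n + 1) * r (k + 1) ^ n * (B * r (k + 1)) := by ring
    _ ≤ kappa (n + 1) * r (k + 1) ^ n * r k := by
        gcongr
        exact (hr.mul_lt hB k).le

/-- If the `δ_k` are summable to the power `1/d`, the ratios of consecutive radii tend to `0`. -/
lemma tendsto_ratio (hr : RadiusSeq B r) {d : ℕ} (hd : 2 ≤ d)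
    (hs : Summable fun k : ℕ => delta d r (k + 1) ^ (1 / (d : ℝ))) :
    Tendsto (fun k => r (k + 1) / r k) atTop (𝓝 0) := by
  have hd0 : 0 < d := by omega
  have hA := constA_pos hd0
  -- One factor `d` undoes the root in the summand, the other the root in `δ`.
  have h1 := hs.tendsto_atTop_zero.pow (d * d)
  have h2 : Tendsto (fun k => (r (k + 1) / r k) ^ (d - 1)) atTop (𝓝 0) := by
    have h3 := h1.div_const (constA d ^ d)
    rw [zero_pow (by positivity), zero_div] at h3
    refine h3.congr fun k => ?_
    rw [pow_mul, one_div, Real.rpow_inv_natCast_pow (hr.delta_nonneg hd0 _) hd0.ne',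
      hr.delta_pow hd0, Nat.add_sub_cancel]
    field_simp
  have h4 := h2.rpow_const (p := ((d - 1 : ℕ) : ℝ)⁻¹) (Or.inr (by positivity))
  have h5 : ((d - 1 : ℕ) : ℝ) ≠ 0 := by
    have : d - 1 ≠ 0 := by omega
    exact_mod_cast this
  rw [Real.zero_rpow (inv_ne_zero h5)] at h4
  refine h4.congr fun k => ?_
  exact Real.pow_rpow_inv_natCast (div_pos (hr.pos _) (hr.pos _)).le (by omega)

lemma tendsto_succ (hr : RadiusSeq B r) (hB : 1 ≤ B)
    (h : Tendsto (fun k => r (k + 1) / r k) atTop (𝓝 0)) :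
    Tendsto (fun k => r (k + 1)) atTop (𝓝 0) := by
  refine squeeze_zero (fun k => (hr.pos _).le) (fun k => ?_) h
  rw [le_div_iff₀ (hr.pos k)]
  nlinarith [hr.le_one hB k, hr.pos (k + 1), hr.pos k]

/-- The `d`-th power of the quotient is `(r_{k+1} / r_k) / κ_d`. -/
lemma tendsto_div_side (hr : RadiusSeq B r) {d : ℕ} (hd : 0 < d)
    (h : Tendsto (fun k => r (k + 1) / r k) atTop (𝓝 0)) :
    Tendsto (fun k => r (k + 1) / side d r (k + 1)) atTop (𝓝 0) := by
  have hd' : (d : ℝ) ≠ 0 := by exact_mod_cast hd.ne'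
  have h1 := (h.div_const (kappa d)).rpow_const (p := (d : ℝ)⁻¹) (Or.inr (by positivity))
  rw [zero_div, Real.zero_rpow (inv_ne_zero hd')] at h1
  refine h1.congr fun k => ?_
  have h2 := hr.pos (k + 1)
  have h3 := hr.pos k
  have h4 := kappa_pos d
  have h5 := hr.side_pos d (k + 1)
  rw [← Real.pow_rpow_inv_natCast (x := r (k + 1) / side d r (k + 1)) (by positivity) hd.ne']
  congr 1
  rw [div_pow, hr.side_pow hd, Nat.add_sub_cancel]
  obtain ⟨n, rfl⟩ : ∃ n, d = n + 1 := ⟨d - 1, by omega⟩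
  rw [Nat.add_sub_cancel, pow_succ]
  field_simp

end RadiusSeq

/-! ### Separation of the balls -/

namespace Construction

variable {d : ℕ} {r : ℕ → ℝ}

/-- The centers of each generation are separated by the side length of the cubes, provided that
the dilated balls are small compared to the cubes. -/
lemma side_le_dist_center (C : Construction d r) (hpos : ∀ k, 0 < r k)
    (hδ : ∀ k, delta d r (k + 1) ≤ 1) (hside : ∀ k, 8 * r (k + 1) ≤ side d r (k + 1)) (k : ℕ) :
    ∀ j j' : Fin (C.count (k + 1)), j ≠ j' →
      side d r (k + 1) ≤ dist (C.center (k + 1) j) (C.center (k + 1) j') := by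
  have hball : ∀ k l, Metric.ball (C.center (k + 1) l) (side d r (k + 1) / 2) ⊆
      Metric.closedBall (C.center k (C.parent k l)) (2 * r k) := fun k l =>
    (Metric.ball_subset_closedBall.trans (closedBall_subset_cube _ _ _)).trans
      ((C.cube_subset k l).trans (Metric.closedBall_subset_closedBall
        (by nlinarith [hδ k, hpos k])))
  have hsame : ∀ k (j j' : Fin (C.count (k + 1))), j ≠ j' → C.parent k j = C.parent k j' →
      side d r (k + 1) ≤ dist (C.center (k + 1) j) (C.center (k + 1) j') := by
    intro k j j' hne hp
    refine le_dist_of_disjoint_ball ((C.cube_disjoint k j j' hne hp).mono ?_ ?_) <;>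
    exact interior_maximal
      (Metric.ball_subset_closedBall.trans (closedBall_subset_cube _ _ _)) Metric.isOpen_ball
  induction k with
  | zero =>
    intro j j' hne
    refine hsame 0 j j' hne ?_
    have : Subsingleton (Fin (C.count 0)) := by rw [C.count_zero]; infer_instance
    exact Subsingleton.elim _ _
  | succ k ih =>
    intro j j' hne
    by_cases hp : C.parent (k + 1) j = C.parent (k + 1) j'
    · exact hsame (k + 1) j j' hne hp
    -- The parents' centers are at least `8 r_{k+1}` apart, so their balls of radius `2 r_{k+1}` are
    -- disjoint.
    · refine le_dist_of_disjoint_ball (Disjoint.mono (hball _ _) (hball _ _) ?_)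
      refine Metric.closedBall_disjoint_closedBall ?_
      linarith [ih _ _ hp, hside k, hpos (k + 1)]

/-- Points of the limit set at distance small compared to the side length of the cubes lie in the
same ball. -/
lemma dist_le_of_dist_le (C : Construction d r) (hpos : ∀ k, 0 < r k)
    (hδ : ∀ k, delta d r (k + 1) ≤ 1) (hside : ∀ k, 8 * r (k + 1) ≤ side d r (k + 1)) (k : ℕ)
    {x y : Space d} (hx : x ∈ C.limitSet) (hy : y ∈ C.limitSet)
    (hxy : dist x y ≤ side d r (k + 1) / 3) : dist x y ≤ 4 * r (k + 1) := by
  have key : ∀ x ∈ C.limitSet, ∃ j, dist x (C.center (k + 1) j) ≤ 2 * r (k + 1) := by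
    intro x hx
    obtain ⟨j, hj⟩ := Set.mem_iUnion.1 (Set.mem_iInter.1 hx (k + 1))
    exact ⟨j, (Metric.mem_closedBall.1 hj).trans
      (by nlinarith [hδ (k + 1), hpos (k + 1)])⟩
  obtain ⟨j, hj⟩ := key x hx
  obtain ⟨j', hj'⟩ := key y hy
  rcases eq_or_ne j j' with rfl | hne
  · linarith [dist_triangle_right x y (C.center (k + 1) j)]
  · have h1 := C.side_le_dist_center hpos hδ hside k j j' hne
    have h2 := dist_triangle4 (C.center (k + 1) j) x y (C.center (k + 1) j')
    rw [dist_comm _ x] at h2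
    -- Different balls would give `s ≤ 4 r_{k+1} + s/3`, hence `s ≤ 6 r_{k+1}`, against `8 r_{k+1} ≤
    -- s`.
    linarith [hside k, hpos (k + 1)]

end Construction

/-! ### Covering Lipschitz images -/

/-- Points of `ℝ^n` in the same cell of a grid of mesh `ρ` are at distance at most `n ρ`. -/
lemma dist_le_of_abs_sub_le {n : ℕ} {a b : Space n} {ρ : ℝ} (h : ∀ i, |a i - b i| ≤ ρ) :
    dist a b ≤ n * ρ := by
  rcases Nat.eq_zero_or_pos n with rfl | hn
  · simp [Subsingleton.elim a b]
  have hρ : 0 ≤ ρ := (abs_nonneg _).trans (h ⟨0, hn⟩)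
  have hn1 : (1 : ℝ) ≤ n := by exact_mod_cast hn
  rw [EuclideanSpace.dist_eq]
  refine Real.sqrt_le_iff.2 ⟨by positivity, ?_⟩
  calc ∑ i, dist (a i) (b i) ^ 2 ≤ ∑ _i : Fin n, ρ ^ 2 := by
        gcongr with i
        exact h i
    _ = n * ρ ^ 2 := by simp
    _ ≤ (n * ρ) ^ 2 := by
        rw [mul_pow]
        gcongr
        nlinarith

/-- A set in which points at distance at most `s k` are at distance at most `q k`, for scales with
`q k → 0` and `q k / s k → 0`, meets the Lipschitz image of a bounded set in a null set. -/
lemma hausdorffMeasure_inter_image_box_eq_zero {n : ℕ} (hn : 0 < n) {X : Type*} [MetricSpace X]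
    [MeasurableSpace X] [BorelSpace X] {E : Set X} {s q : ℕ → ℝ} (hs : ∀ k, 0 < s k)
    (hq0 : ∀ k, 0 ≤ q k)
    (hq : Tendsto q atTop (𝓝 0)) (hqs : Tendsto (fun k => q k / s k) atTop (𝓝 0))
    (hE : ∀ k, ∀ x ∈ E, ∀ y ∈ E, dist x y ≤ s k → dist x y ≤ q k)
    {f : Space n → X} {K : NNReal} (hf : LipschitzWith K f) (R : ℝ) :
    μH[(n : ℝ)] (E ∩ f '' {a | ∀ i, |a i| ≤ R}) = 0 := by
  have hn' : (0 : ℝ) < n := by exact_mod_cast hn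
  -- Adding `1` keeps the mesh `ρ` well defined when `K = 0`.
  set L : ℝ := K + 1 with hL
  have hL0 : 0 < L := by positivity
  set ρ : ℕ → ℝ := fun k => s k / (L * n) with hρ
  have hρ0 : ∀ k, 0 < ρ k := fun k => by have := hs k; positivity
  set m : ℕ → ℕ := fun k => ⌊2 * R / ρ k⌋₊ + 1 with hm
  let cell : (k : ℕ) → (Fin n → Fin (m k)) → Set X := fun k c =>
    E ∩ f '' {a | ∀ i, |a i| ≤ R ∧ ⌊(a i + R) / ρ k⌋₊ = (c i : ℕ)}
  have hdiam : ∀ k c, Metric.ediam (cell k c) ≤ ENNReal.ofReal (q k) := by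
    intro k c
    refine Metric.ediam_le ?_
    rintro _ ⟨hx, a, ha, rfl⟩ _ ⟨hy, b, hb, rfl⟩
    rw [edist_dist]
    refine ENNReal.ofReal_le_ofReal (hE k _ hx _ hy ?_)
    have hab : dist a b ≤ n * ρ k := by
      refine dist_le_of_abs_sub_le fun i => ?_
      obtain ⟨ha1, ha2⟩ := ha i
      obtain ⟨hb1, hb2⟩ := hb i
      have hρk := hρ0 k
      have h1 := Nat.floor_le (div_nonneg (by linarith [abs_le.1 ha1]) hρk.le :
        0 ≤ (a i + R) / ρ k)
      have h2 := Nat.floor_le (div_nonneg (by linarith [abs_le.1 hb1]) hρk.le :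
        0 ≤ (b i + R) / ρ k)
      have h3 := Nat.lt_floor_add_one ((a i + R) / ρ k)
      have h4 := Nat.lt_floor_add_one ((b i + R) / ρ k)
      rw [ha2] at h1 h3
      rw [hb2] at h2 h4
      rw [le_div_iff₀ hρk] at h1 h2
      rw [div_lt_iff₀ hρk] at h3 h4
      rw [abs_le]
      constructor <;> linarith
    calc dist (f a) (f b) ≤ K * dist a b := hf.dist_le_mul a b
      _ ≤ L * (n * ρ k) := by gcongr; linarith
      _ = s k := by simp only [hρ]; field_simp
  have hcover : ∀ k, E ∩ f '' {a | ∀ i, |a i| ≤ R} ⊆ ⋃ c, cell k c := by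
    rintro k _ ⟨hx, a, ha, rfl⟩
    have hlt : ∀ i, ⌊(a i + R) / ρ k⌋₊ < m k := fun i => by
      refine Nat.lt_succ_of_le (Nat.floor_le_floor ?_)
      have := hρ0 k
      gcongr
      linarith [abs_le.1 (ha i)]
    exact Set.mem_iUnion.2 ⟨fun i => ⟨_, hlt i⟩, hx, a, fun i => ⟨ha i, rfl⟩, rfl⟩
  have hqE : Tendsto (fun k => ENNReal.ofReal (q k)) atTop (𝓝 0) := by
    simpa using ENNReal.tendsto_ofReal hq
  have hle := Measure.hausdorffMeasure_le_liminf_sum (n : ℝ) (E ∩ f '' {a | ∀ i, |a i| ≤ R})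
    _ hqE cell (Eventually.of_forall hdiam) (Eventually.of_forall hcover)
  -- The `m^n` cells contribute at most `(m q)^n`, and `m` is at most a constant over `s`, plus `1`.
  have hmq : Tendsto (fun k => (m k : ℝ) * q k) atTop (𝓝 0) := by
    have h1 : Tendsto (fun k => 2 * |R| * (L * n) * (q k / s k) + q k) atTop (𝓝 0) := by
      simpa using (hqs.const_mul (2 * |R| * (L * n))).add hq
    refine squeeze_zero (fun k => mul_nonneg (Nat.cast_nonneg _) (hq0 k)) (fun k => ?_) h1
    have hsk := hs k
    have h2 : (m k : ℝ) ≤ 2 * |R| / ρ k + 1 := by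
      have h3 : ⌊2 * R / ρ k⌋₊ ≤ ⌊2 * |R| / ρ k⌋₊ := by
        refine Nat.floor_le_floor ?_
        have := hρ0 k
        gcongr
        exact le_abs_self R
      have h4 := Nat.floor_le (div_nonneg (by positivity) (hρ0 k).le : 0 ≤ 2 * |R| / ρ k)
      have h5 : (⌊2 * R / ρ k⌋₊ : ℝ) ≤ ⌊2 * |R| / ρ k⌋₊ := by exact_mod_cast h3
      simp only [hm, Nat.cast_add, Nat.cast_one]
      linarith
    calc (m k : ℝ) * q k ≤ (2 * |R| / ρ k + 1) * q k :=
          mul_le_mul_of_nonneg_right h2 (hq0 k)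
      _ = 2 * |R| * (L * n) * (q k / s k) + q k := by simp only [hρ]; field_simp
  have hlim : Tendsto (fun k => ENNReal.ofReal (((m k : ℝ) * q k) ^ n)) atTop (𝓝 0) := by
    simpa [hn.ne'] using ENNReal.tendsto_ofReal (hmq.pow n)
  refine le_antisymm (hle.trans ?_) zero_le
  rw [← hlim.liminf_eq]
  refine liminf_le_liminf (Eventually.of_forall fun k => ?_)
  calc ∑ c, Metric.ediam (cell k c) ^ (n : ℝ)
      ≤ ∑ _c : Fin n → Fin (m k), ENNReal.ofReal (q k) ^ (n : ℝ) := by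
        gcongr with c
        exact hdiam k c
    _ = ENNReal.ofReal (((m k : ℝ) * q k) ^ n) := by
        rw [ENNReal.ofReal_pow (mul_nonneg (Nat.cast_nonneg _) (hq0 k)),
          ENNReal.ofReal_mul (Nat.cast_nonneg _), mul_pow]
        simp

/-- A set in which points at distance at most `s k` are at distance at most `q k`, for scales with
`q k → 0` and `q k / s k → 0`, is purely unrectifiable. -/
lemma purelyUnrectifiable_of_gaps {d n : ℕ} (hn : 0 < n) {E : Set (Space d)} {s q : ℕ → ℝ}
    (hs : ∀ k, 0 < s k) (hq0 : ∀ k, 0 ≤ q k)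
    (hq : Tendsto q atTop (𝓝 0)) (hqs : Tendsto (fun k => q k / s k) atTop (𝓝 0))
    (hE : ∀ k, ∀ x ∈ E, ∀ y ∈ E, dist x y ≤ s k → dist x y ≤ q k) :
    PurelyUnrectifiable n E := by
  rintro F ⟨f, hf, hF⟩
  have hsub : E ∩ F ⊆ (F \ ⋃ i, Set.range (f i)) ∪
      ⋃ (i : ℕ) (R : ℕ), E ∩ f i '' {a | ∀ j, |a j| ≤ (R : ℝ)} := by
    rintro x ⟨hxE, hxF⟩
    by_cases hx : x ∈ ⋃ i, Set.range (f i)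
    · obtain ⟨i, a, rfl⟩ := Set.mem_iUnion.1 hx
      obtain ⟨R, hR⟩ := exists_nat_ge ‖a‖
      exact Or.inr (Set.mem_iUnion₂.2 ⟨i, R, hxE, a,
        fun j => (PiLp.norm_apply_le a j).trans hR, rfl⟩)
    · exact Or.inl ⟨hxF, hx⟩
  refine measure_mono_null hsub (measure_union_null hF ?_)
  refine measure_iUnion_null fun i => measure_iUnion_null fun R => ?_
  obtain ⟨K, hK⟩ := hf i
  exact hausdorffMeasure_inter_image_box_eq_zero hn hs hq0 hq hqs hE hK R

end PackedCantor

theorem lemma3p2 (d : ℕ) (hd : 2 ≤ d) :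
    ∃ B : ℝ, 1 ≤ B ∧
      ∀ r : ℕ → ℝ, PackedCantor.RadiusSeq B r →
        ∀ C : PackedCantor.Construction d r,
          Summable (fun k : ℕ => PackedCantor.delta d r (k + 1) ^ (1 / (d : ℝ))) →
            PackedCantor.PurelyUnrectifiable (d - 1) C.limitSet := by
  have hd0 : 0 < d := by omega
  have hA := PackedCantor.constA_pos hd0
  have hκ := PackedCantor.kappa_pos d
  have hA' : 0 < PackedCantor.constA d ^ d := by positivity
  have hκ' : 0 < 8 ^ d / PackedCantor.kappa d := by positivity
  -- The sum dominates each of the three lower bounds needed: `1`, `A^d` for `δ ≤ 1`, and `8^d /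
  -- κ_d` for the cube sides.
  refine ⟨1 + PackedCantor.constA d ^ d + 8 ^ d / PackedCantor.kappa d, by linarith, ?_⟩
  intro r hr C hsum
  have hB : 1 ≤ 1 + PackedCantor.constA d ^ d + 8 ^ d / PackedCantor.kappa d := by linarith
  have hratio := hr.tendsto_ratio hd hsum
  have hδ := hr.delta_le_one hB hd (by linarith)
  have hside := hr.eight_mul_le_side hB hd0 (by linarith)
  refine PackedCantor.purelyUnrectifiable_of_gaps (by omega)
    (s := fun k => PackedCantor.side d r (k + 1) / 3) (q := fun k => 4 * r (k + 1))
    (fun k => div_pos (hr.side_pos d _) three_pos) (fun k => by linarith [hr.pos (k + 1)]) ?_ ?_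
    (fun k x hx y hy hxy => C.dist_le_of_dist_le hr.pos hδ hside k hx hy hxy)
  · simpa using (hr.tendsto_succ hB hratio).const_mul 4
  · have h := (hr.tendsto_div_side hd0 hratio).const_mul 12
    rw [mul_zero] at h
    refine h.congr fun k => ?_
    have := hr.side_pos d (k + 1)
    field_simp
    ring
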